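/- Let $\mathbb{R}_{++}$ denote the set of positive real numbers, let \[ C=\{(x,y,z)\in\mathbb{R}^{3}\mid x\geq 0,\ y\geq 0,\ z\geq 0,\ x+y+z>0\}, \] and let $C^{\circ}$ denote the interior of $C$. Let $\varepsilon_{1},\varepsilon_{2},\varepsilon_{3}$ be nonnegative real numbers, let $\alpha\in\mathbb{R}$, and assume that the function $H:C\to\mathbb{R}$ satisfies the following three conditions. (i) $\left|H(p_1,p_2,p_3)-H(p_{\sigma(1)},p_{\sigma(2)},p_{\sigma(3)})\right|\leq\varepsilon_{1}$ for all $(p_1,p_2,p_3)\in C$ and all permutations $\sigma$ of $\{1,2,3\}$; (ii) $\left|H(x,y,z)-H(x+y,0,z)-H(x,y,0)\right|\leq\varepsilon_{2}$ for all $(x,y,z)\in C^{\circ}$; (iii) $\left|H(tx,ty,0)-t^{\alpha}H(x,y,0)\right|\leq\varepsilon_{3}$ for all $t,x,y\in\mathbb{R}_{++}$. Then: if $\alpha=1$, there exists a function $\varphi:\mathbb{R}_{++}\to\mathbb{R}$ such that $\varphi(xy)=x\varphi(y)+y\varphi(x)$ for all $x,y\in\mathbb{R}_{++}$ and \[ \left|H(x,y,z)-\left[\varphi(x+y+z)-\varphi(x)-\varphi(y)-\varphi(z)\right]\right|\leq\varepsilon_{1}+\varepsilon_{2}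 \qquad\text{for all }(x,y,z)\in C^{\circ}; \] if $\alpha=0$, there exists a constant $a\in\mathbb{R}$ such that \[ \left|H(x,y,z)-a\right|\leq 8\varepsilon_{3}+25\varepsilon_{2}+49\varepsilon_{1} \qquad\text{for all }(x,y,z)\in C^{\circ}; \] if $\alpha\notin\{0,1\}$, there exists a constant $c\in\mathbb{R}$ such that \[ \left|H(x,y,z)-c\left[(x+y+z)^{\alpha}-x^{\alpha}-y^{\alpha}-z^{\alpha}\right]\right|\leq\varepsilon_{1}+\varepsilon_{2} \qquad\text{for all }(x,y,z)\in C^{\circ}. \] -/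

import Mathlib

/-- The cone `C` of all nonzero points of `ℝ³` with nonnegative coordinates. -/
def entropyCone : Set (Fin 3 → ℝ) :=
  {p | 0 ≤ p 0 ∧ 0 ≤ p 1 ∧ 0 ≤ p 2 ∧ 0 < p 0 + p 1 + p 2}

open scoped NNReal

/-! Put F(x,y) = H(x,y,0). Conditions (i) and (ii) put H(x,y,z) within ε₁ + ε₂ of F(x+y,z) + F(x,y),
so F is an approximately symmetric approximate cocycle. If α ≠ 0, scaling by s multiplies every
defect by s^α while the bounds stay fixed, so all defects vanish (`eq_zero_of_rpow_mul_abs_le`). For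
α ≠ 1 the doubling estimate `abs_cocycle_doubling_le` then determines F, approximately when α = 0.
For α = 1, divisibility of ℝ makes F the Cauchy difference of some g. The Leibniz defect of g is a
symmetric Hochschild cocycle of the field ℝ; formal smoothness over ℚ makes it a coboundary of an
additive u, and g + u is the required φ. -/

/-- A field of characteristic zero is formally smooth over `ℚ`. -/
theorem formallySmooth_rat_of_charZero (K : Type*) [Field K] [CharZero K] :
    Algebra.FormallySmooth ℚ K := by
  obtain ⟨s, hs⟩ := exists_isTranscendenceBasis ℚ K
  -- In characteristic zero, algebraic over ℚ(s) means separable over it.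
  have := hs.isAlgebraic_field
  exact .of_algebraicIndependent_of_isSeparable hs.1

/-! ### Hochschild cocycles and square-zero extensions -/

/-- A symmetric Hochschild 2-cocycle of a field with values in the field itself. -/
structure SymmHochschildCocycle (K : Type*) [Field K] where
  /-- The underlying function of two variables. -/
  toFun : K → K → K
  symm : ∀ x y, toFun x y = toFun y x
  add_left : ∀ x y z, toFun (x + y) z = toFun x z + toFun y z
  cocycle : ∀ x y z, x * toFun y z + toFun x (y * z) = toFun (x * y) z + z * toFun x y

namespace SymmHochschildCocycle

variable {K : Type*} [Field K] (M : SymmHochschildCocycle K)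

theorem add_right (x y z : K) : M.toFun x (y + z) = M.toFun x y + M.toFun x z := by
  rw [M.symm, M.add_left, M.symm y, M.symm z]

theorem zero_left (x : K) : M.toFun 0 x = 0 := by
  simpa using M.add_left 0 0 x

theorem one_left (x : K) : M.toFun 1 x = x * M.toFun 1 1 := by
  simpa using M.cocycle 1 1 x

/-- The square-zero extension of `K` by `K` attached to a symmetric Hochschild 2-cocycle. -/
def Ext (_ : SymmHochschildCocycle K) : Type _ := K × K

instance : AddCommGroup M.Ext := inferInstanceAs (AddCommGroup (K × K))

instance : CommRing M.Ext where
  __ := (inferInstance : AddCommGroup M.Ext)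
  mul p q := (p.1 * q.1, p.1 * q.2 + q.1 * p.2 + M.toFun p.1 q.1)
  -- The cocycle need not be normalised, so the unit is shifted.
  one := (1, -M.toFun 1 1)
  mul_comm p q := Prod.ext (mul_comm p.1 q.1) (by
    change p.1 * q.2 + q.1 * p.2 + M.toFun p.1 q.1 = q.1 * p.2 + p.1 * q.2 + M.toFun q.1 p.1
    rw [M.symm]; ring)
  mul_assoc p q r := Prod.ext (mul_assoc p.1 q.1 r.1) (by
    change p.1 * q.1 * r.2 + r.1 * (p.1 * q.2 + q.1 * p.2 + M.toFun p.1 q.1)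
        + M.toFun (p.1 * q.1) r.1
      = p.1 * (q.1 * r.2 + r.1 * q.2 + M.toFun q.1 r.1) + q.1 * r.1 * p.2
        + M.toFun p.1 (q.1 * r.1)
    linear_combination -M.cocycle p.1 q.1 r.1)
  left_distrib p q r := Prod.ext (mul_add p.1 q.1 r.1) (by
    change p.1 * (q.2 + r.2) + (q.1 + r.1) * p.2 + M.toFun p.1 (q.1 + r.1)
      = p.1 * q.2 + q.1 * p.2 + M.toFun p.1 q.1 + (p.1 * r.2 + r.1 * p.2 + M.toFun p.1 r.1)
    rw [M.add_right]; ring)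
  right_distrib p q r := Prod.ext (add_mul p.1 q.1 r.1) (by
    change (p.1 + q.1) * r.2 + r.1 * (p.2 + q.2) + M.toFun (p.1 + q.1) r.1
      = p.1 * r.2 + r.1 * p.2 + M.toFun p.1 r.1 + (q.1 * r.2 + r.1 * q.2 + M.toFun q.1 r.1)
    rw [M.add_left]; ring)
  zero_mul p := Prod.ext (zero_mul p.1) (by
    change 0 * p.2 + p.1 * 0 + M.toFun 0 p.1 = 0
    rw [M.zero_left]; ring)
  mul_zero p := Prod.ext (mul_zero p.1) (by
    change p.1 * 0 + 0 * p.2 + M.toFun p.1 0 = 0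
    rw [M.symm, M.zero_left]; ring)
  one_mul p := Prod.ext (one_mul p.1) (by
    change 1 * p.2 + p.1 * (-M.toFun 1 1) + M.toFun 1 p.1 = p.2
    rw [M.one_left p.1]; ring)
  mul_one p := Prod.ext (mul_one p.1) (by
    change p.1 * (-M.toFun 1 1) + 1 * p.2 + M.toFun p.1 1 = p.2
    rw [M.symm p.1, M.one_left p.1]; ring)

/-- The projection of the extension onto the field. -/
def proj : M.Ext →+* K where
  toFun p := p.1
  map_one' := rfl
  map_mul' _ _ := rfl
  map_zero' := rfl
  map_add' _ _ := rfl

theorem mul_eq_zero_of_proj_eq_zero {p q : M.Ext} (hp : M.proj p = 0) (hq : M.proj q = 0) :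
    p * q = 0 := by
  change p.1 = 0 at hp
  change q.1 = 0 at hq
  refine Prod.ext ?_ ?_
  · change p.1 * q.1 = 0
    rw [hp, zero_mul]
  · change p.1 * q.2 + q.1 * p.2 + M.toFun p.1 q.1 = 0
    rw [hp, hq, M.zero_left]; ring

variable [CharZero K]

instance : Module ℚ M.Ext := inferInstanceAs (Module ℚ (K × K))

instance : Algebra ℚ M.Ext :=
  Algebra.ofModule
    (fun r p q => by
      simpa using map_rat_smul (AddMonoidHom.mulRight q) r p)
    (fun r p q => by
      simpa using map_rat_smul (AddMonoidHom.mulLeft p) r q)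

/-- Over a field of characteristic zero every symmetric Hochschild 2-cocycle is a coboundary. -/
theorem exists_coboundary : ∃ u : K → K, (∀ x y, u (x + y) = u x + u y) ∧
    ∀ x y, u (x * y) = x * u y + y * u x + M.toFun x y := by
  have := formallySmooth_rat_of_charZero K
  let π : M.Ext →ₐ[ℚ] K := M.proj.toRatAlgHom
  have hπ : Function.Surjective π := fun x => ⟨((x, 0) : K × K), rfl⟩
  have hker : IsNilpotent (RingHom.ker (π : M.Ext →+* K)) := by
    refine ⟨2, ?_⟩
    rw [pow_two, Ideal.zero_eq_bot, eq_bot_iff, Ideal.mul_le]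
    intro p hp q hq
    exact M.mul_eq_zero_of_proj_eq_zero hp hq
  -- A ring section of the square-zero extension; its second component is the cochain sought.
  let s := Algebra.FormallySmooth.liftOfSurjective (AlgHom.id ℚ K) π hπ hker
  have hs (x : K) : (s x).1 = x :=
    Algebra.FormallySmooth.liftOfSurjective_apply (AlgHom.id ℚ K) π hπ hker x
  refine ⟨fun x => (s x).2, fun x y => ?_, fun x y => ?_⟩
  · change (s (x + y)).2 = _
    rw [map_add]; rfl
  · change (s (x * y)).2 = _
    rw [map_mul]
    change (s x).1 * (s y).2 + (s y).1 * (s x).2 + M.toFun (s x).1 (s y).1 = _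
    rw [hs, hs]

end SymmHochschildCocycle

/-! ### Additive cocycles and divisibility -/

/-- A normalised symmetric 2-cocycle on the additive monoid of nonnegative reals. -/
structure NNRealCocycle where
  /-- The underlying function of two variables. -/
  toFun : ℝ≥0 → ℝ≥0 → ℝ
  symm : ∀ x y, toFun x y = toFun y x
  zero_left : ∀ x, toFun 0 x = 0
  cocycle : ∀ x y z, toFun x y + toFun (x + y) z = toFun y z + toFun x (y + z)

namespace NNRealCocycle

variable (G : NNRealCocycle)

/-- The extension of the monoid of nonnegative reals by `ℝ` attached to a cocycle. -/
def Ext (_ : NNRealCocycle) : Type := ℝ≥0 × ℝ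

instance : Add G.Ext := ⟨fun p q => (p.1 + q.1, p.2 + q.2 + G.toFun p.1 q.1)⟩

instance : Zero G.Ext := ⟨((0, 0) : ℝ≥0 × ℝ)⟩

instance : AddCommMonoid G.Ext where
  nsmul := nsmulRec
  add_assoc p q r := Prod.ext (add_assoc p.1 q.1 r.1) (by
    change p.2 + q.2 + G.toFun p.1 q.1 + r.2 + G.toFun (p.1 + q.1) r.1
      = p.2 + (q.2 + r.2 + G.toFun q.1 r.1) + G.toFun p.1 (q.1 + r.1)
    linear_combination G.cocycle p.1 q.1 r.1)
  zero_add p := Prod.ext (zero_add p.1) (by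
    change 0 + p.2 + G.toFun 0 p.1 = p.2
    rw [G.zero_left]; ring)
  add_zero p := Prod.ext (add_zero p.1) (by
    change p.2 + 0 + G.toFun p.1 0 = p.2
    rw [G.symm, G.zero_left]; ring)
  add_comm p q := Prod.ext (add_comm p.1 q.1) (by
    change p.2 + q.2 + G.toFun p.1 q.1 = q.2 + p.2 + G.toFun q.1 p.1
    rw [G.symm]; ring)

instance : IsLeftCancelAdd G.Ext := ⟨by
  intro p q r h
  have h1 : p.1 + q.1 = p.1 + r.1 := congrArg Prod.fst h
  have h2 : p.2 + q.2 + G.toFun p.1 q.1 = p.2 + r.2 + G.toFun p.1 r.1 := congrArg Prod.snd h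
  have h3 : q.1 = r.1 := add_left_cancel h1
  refine Prod.ext h3 ?_
  rw [h3] at h2
  linarith⟩

instance : IsCancelAdd G.Ext := AddCommMagma.IsLeftCancelAdd.toIsCancelAdd G.Ext

/-- The inclusion of `ℝ` into the extension. -/
def incl : ℝ →+ G.Ext where
  toFun a := (0, a)
  map_zero' := rfl
  map_add' a b := Prod.ext (add_zero (0 : ℝ≥0)).symm (by
    change a + b = a + b + G.toFun 0 0
    rw [G.zero_left, add_zero])

/-- Every normalised symmetric real cocycle on the nonnegative reals is a coboundary. -/
theorem exists_coboundary :
    ∃ f : ℝ≥0 → ℝ, ∀ x y, G.toFun x y = f (x + y) - f x - f y := by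
  let j : G.Ext →+ Algebra.GrothendieckAddGroup G.Ext := Algebra.GrothendieckAddGroup.of
  have hj : Function.Injective j := Algebra.GrothendieckAddGroup.of_injective
  have hi : Function.Injective (j.comp G.incl) :=
    hj.comp fun a b h => congrArg Prod.snd h
  -- ℝ is divisible, hence injective, so its inclusion into the Grothendieck group has a retraction.
  -- Cancellativity of the extension keeps that inclusion injective.
  obtain ⟨r, hr⟩ := (Module.Baer.of_divisible ℝ).extension_property_addMonoidHom
    (j.comp G.incl) hi (AddMonoidHom.id ℝ)
  have hr' (a : ℝ) : r (j (G.incl a)) = a := DFunLike.congr_fun hr a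
  let e (x : ℝ≥0) : G.Ext := ((x, 0) : ℝ≥0 × ℝ)
  refine ⟨fun x => - r (j (e x)), fun x y => ?_⟩
  have h : e x + e y = e (x + y) + G.incl (G.toFun x y) :=
    Prod.ext (add_zero (x + y)).symm (by
      change 0 + 0 + G.toFun x y = 0 + G.toFun x y + G.toFun (x + y) 0
      rw [G.symm (x + y), G.zero_left]; ring)
  have h2 := congrArg (fun p => r (j p)) h
  simp only [map_add, hr'] at h2
  linarith

end NNRealCocycle

open Classical in
/-- A symmetric real cocycle on the positive reals is a coboundary. -/
theorem exists_coboundary_of_pos (F : ℝ → ℝ → ℝ)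
    (hs : ∀ x y, 0 < x → 0 < y → F x y = F y x)
    (hc : ∀ x y z, 0 < x → 0 < y → 0 < z → F (x + y) z + F x y = F (y + z) x + F y z) :
    ∃ f : ℝ → ℝ, ∀ x y, 0 < x → 0 < y → F x y = f (x + y) - f x - f y := by
  let G : NNRealCocycle :=
    { toFun := fun x y => if x = 0 ∨ y = 0 then 0 else F x y
      symm := fun x y => by
        by_cases hx : x = 0
        · simp [hx]
        by_cases hy : y = 0
        · simp [hy]
        simpa [hx, hy] using hs x y (by positivity) (by positivity)
      zero_left := fun x => by simp
      cocycle := fun x y z => by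
        by_cases hx : x = 0
        · simp [hx]
        by_cases hy : y = 0
        · simp [hy]
        by_cases hz : z = 0
        · simp [hz]
        have hx' : (0 : ℝ) < x := by positivity
        have hy' : (0 : ℝ) < y := by positivity
        have hz' : (0 : ℝ) < z := by positivity
        have h1 := hc x y z hx' hy' hz'
        have h2 := hs (y + z) x (by positivity) hx'
        simp only [hx, hy, hz, add_eq_zero, false_and, or_self, if_false, NNReal.coe_add]
        linarith }
  obtain ⟨f, hf⟩ := G.exists_coboundary
  refine ⟨fun x => f x.toNNReal, fun x y hx hy => ?_⟩
  have h := hf x.toNNReal y.toNNReal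
  rw [← Real.toNNReal_add hx.le hy.le] at h
  rw [← h]
  simp [G, not_le.mpr hx, not_le.mpr hy, hx.le, hy.le]

/-- An odd function that is additive on the positive reals is additive. -/
theorem additive_of_odd_of_pos (h : ℝ → ℝ) (hodd : ∀ x, h (-x) = -h x)
    (hpos : ∀ x y, 0 < x → 0 < y → h (x + y) = h x + h y) (x y : ℝ) :
    h (x + y) = h x + h y := by
  have h0 : h 0 = 0 := by have := hodd 0; rw [neg_zero] at this; linarith
  have key : ∀ a b, 0 < a → b < 0 → h (a + b) = h a + h b := by
    intro a b ha hb
    have hnb := hodd b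
    rcases lt_trichotomy (a + b) 0 with hab | hab | hab
    · have h1 := hpos a (-(a + b)) ha (by linarith)
      rw [show a + -(a + b) = -b by ring, hodd (a + b)] at h1
      linarith
    · rw [hab, h0, show b = -a by linarith, hodd]; ring
    · have h1 := hpos (a + b) (-b) hab (by linarith)
      rw [show a + b + -b = a by ring] at h1
      linarith
  rcases lt_trichotomy x 0 with hx | rfl | hx
  · rcases lt_trichotomy y 0 with hy | rfl | hy
    · have h1 := hpos (-x) (-y) (by linarith) (by linarith)
      rw [show -x + -y = -(x + y) by ring, hodd, hodd, hodd] at h1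
      linarith
    · simp [h0]
    · rw [add_comm, key y x hy hx, add_comm]
  · simp [h0]
  · rcases lt_trichotomy y 0 with hy | rfl | hy
    · exact key x y hx hy
    · simp [h0]
    · exact hpos x y hx hy

/-- A symmetric cocycle on the positive reals that is homogeneous of degree one is the Cauchy
difference of a function satisfying the Leibniz rule. -/
theorem exists_leibniz_of_homogeneous_cocycle (F : ℝ → ℝ → ℝ)
    (hs : ∀ x y, 0 < x → 0 < y → F x y = F y x)
    (hc : ∀ x y z, 0 < x → 0 < y → 0 < z → F (x + y) z + F x y = F (y + z) x + F y z)
    (hh : ∀ t x y, 0 < t → 0 < x → 0 < y → F (t * x) (t * y) = t * F x y) :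
    ∃ φ : ℝ → ℝ, (∀ x y, 0 < x → 0 < y → φ (x * y) = x * φ y + y * φ x) ∧
      ∀ x y, 0 < x → 0 < y → F x y = φ (x + y) - φ x - φ y := by
  obtain ⟨f, hf⟩ := exists_coboundary_of_pos F hs hc
  -- The odd extension makes the Leibniz defect `m` odd in each variable, so its additivity need
  -- only be checked on positive reals, where it is the homogeneity of F.
  let g (x : ℝ) : ℝ := if 0 < x then f x else if x < 0 then -f (-x) else 0
  have hgpos (x : ℝ) (hx : 0 < x) : g x = f x := if_pos hx
  have hgodd (x : ℝ) : g (-x) = -g x := by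
    rcases lt_trichotomy x 0 with hx | rfl | hx
    · simp [g, hx, hx.not_gt]
    · simp [g]
    · simp [g, hx, hx.not_gt]
  have hg (x y : ℝ) (hx : 0 < x) (hy : 0 < y) : F x y = g (x + y) - g x - g y := by
    rw [hgpos x hx, hgpos y hy, hgpos _ (add_pos hx hy), hf x y hx hy]
  let m (x y : ℝ) : ℝ := x * g y + y * g x - g (x * y)
  have hmsymm (x y : ℝ) : m x y = m y x := by simp only [m, mul_comm y x]; ring
  have hmodd (x z : ℝ) : m (-x) z = -m x z := by
    simp only [m, neg_mul, hgodd]; ring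
  have hmpos (z : ℝ) (hz : 0 < z) (x y : ℝ) : m (x + y) z = m x z + m y z := by
    refine additive_of_odd_of_pos (fun x => m x z) (fun x => hmodd x z) (fun x y hx hy => ?_) x y
    have h1 := hh z x y hz hx hy
    rw [hg x y hx hy, hg _ _ (mul_pos hz hx) (mul_pos hz hy), ← mul_add] at h1
    simp only [m, mul_comm _ z]
    linarith
  let M : SymmHochschildCocycle ℝ :=
    { toFun := m
      symm := hmsymm
      add_left := fun x y z => by
        rcases lt_trichotomy z 0 with hz | rfl | hz
        · have h1 := hmpos (-z) (by linarith) x y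
          have h2 (w : ℝ) : m w (-z) = -m w z := by rw [hmsymm, hmodd, hmsymm]
          simp only [h2] at h1
          linarith
        · have h2 (w : ℝ) : m w 0 = 0 := by
            have := hmodd 0 w
            rw [neg_zero] at this
            rw [hmsymm]; linarith
          simp [h2]
        · exact hmpos z hz x y
      cocycle := fun x y z => by simp only [m, mul_assoc]; ring }
  obtain ⟨u, hadd, hmul⟩ := M.exists_coboundary
  -- Additivity of `u` leaves the Cauchy difference unchanged, while its coboundary cancels the
  -- Leibniz defect.
  refine ⟨fun x => g x + u x, fun x y _ _ => ?_, fun x y hx hy => ?_⟩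
  · have h1 : u (x * y) = x * u y + y * u x + (x * g y + y * g x - g (x * y)) := hmul x y
    simp only [h1]; ring
  · simp only [hg x y hx hy, hadd]; ring

/-! ### Doubling and homogeneity -/

/-- Doubling estimate for approximately symmetric approximate cocycles. -/
theorem abs_cocycle_doubling_le (F : ℝ → ℝ → ℝ) (δ₁ δ₂ : ℝ)
    (hs : ∀ x y, 0 < x → 0 < y → |F x y - F y x| ≤ δ₁)
    (hc : ∀ x y z, 0 < x → 0 < y → 0 < z →
      |F (x + y) z + F x y - (F (y + z) x + F y z)| ≤ δ₂)
    (x y : ℝ) (hx : 0 < x) (hy : 0 < y) :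
    |F (x + y) (x + y) + 2 * F x y - (F (2 * x) (2 * y) + F x x + F y y)| ≤ δ₁ + 3 * δ₂ := by
  -- The combination h3 - h1 - h2 cancels every mixed term except F(2y,2x), which `h4` swaps.
  have h1 := hc (x + y) x y (by positivity) hx hy
  have h2 := hc x x y hx hx hy
  have h3 := hc (2 * x) y y (by positivity) hy hy
  have h4 := hs (2 * y) (2 * x) (by positivity) (by positivity)
  rw [show x + y + x = 2 * x + y by ring] at h1
  rw [← two_mul] at h2 h3
  rw [abs_le] at *
  constructor <;> linarith

/-- A number all of whose multiples by powers `s ^ α`, with `α ≠ 0`, are bounded vanishes. -/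
theorem eq_zero_of_rpow_mul_abs_le {α d C : ℝ} (hα : α ≠ 0)
    (h : ∀ s : ℝ, 0 < s → s ^ α * |d| ≤ C) : d = 0 := by
  by_contra hd
  have hd' : 0 < |d| := abs_pos.mpr hd
  have hC : 0 ≤ C := le_trans (by positivity) (h 1 one_pos)
  have hr : 0 < (C + 1) / |d| := by positivity
  have h1 := h (((C + 1) / |d|) ^ α⁻¹) (Real.rpow_pos_of_pos hr _)
  rw [Real.rpow_inv_rpow hr.le hα, div_mul_cancel₀ _ hd'.ne'] at h1
  linarith

/-- Approximate homogeneity of nonzero degree is exact homogeneity. -/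
theorem homogeneous_of_approx (F : ℝ → ℝ → ℝ) {α ε : ℝ} (hα : α ≠ 0)
    (hh : ∀ t x y, 0 < t → 0 < x → 0 < y → |F (t * x) (t * y) - t ^ α * F x y| ≤ ε)
    (t x y : ℝ) (ht : 0 < t) (hx : 0 < x) (hy : 0 < y) :
    F (t * x) (t * y) = t ^ α * F x y := by
  refine sub_eq_zero.mp (eq_zero_of_rpow_mul_abs_le (C := 2 * ε) hα fun s hs => ?_)
  -- F(stx, sty) is estimated in two ways, by scaling with s and with st; hence 2ε.
  have h1 := hh s (t * x) (t * y) hs (by positivity) (by positivity)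
  have h2 := hh (s * t) x y (by positivity) hx hy
  rw [Real.mul_rpow hs.le ht.le, mul_assoc, mul_assoc] at h2
  rw [← abs_of_pos (Real.rpow_pos_of_pos hs α), ← abs_mul]
  rw [abs_le] at *
  constructor <;> linarith

/-- A homogeneous symmetric cocycle of degree different from one is a multiple of the Cauchy
difference of a power. -/
theorem eq_rpow_of_homogeneous_cocycle (F : ℝ → ℝ → ℝ) {α : ℝ} (hα : α ≠ 1)
    (hs : ∀ x y, 0 < x → 0 < y → F x y = F y x)
    (hc : ∀ x y z, 0 < x → 0 < y → 0 < z → F (x + y) z + F x y = F (y + z) x + F y z)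
    (hh : ∀ t x y, 0 < t → 0 < x → 0 < y → F (t * x) (t * y) = t ^ α * F x y)
    (x y : ℝ) (hx : 0 < x) (hy : 0 < y) :
    F x y = F 1 1 / (2 ^ α - 2) * ((x + y) ^ α - x ^ α - y ^ α) := by
  have h := abs_cocycle_doubling_le F 0 0 (fun x y hx hy => by simp [hs x y hx hy])
    (fun x y z hx hy hz => by simp [hc x y z hx hy hz]) x y hx hy
  have hdiag (w : ℝ) (hw : 0 < w) : F w w = w ^ α * F 1 1 := by
    simpa using hh w 1 1 hw one_pos one_pos
  rw [hdiag _ (add_pos hx hy), hdiag x hx, hdiag y hy, hh 2 x y two_pos hx hy] at h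
  have h' := abs_nonpos_iff.mp (h.trans (by norm_num))
  have h2 : (2 : ℝ) ^ α - 2 ≠ 0 := by
    intro h0
    refine hα ((Real.rpow_right_inj (two_pos) (by norm_num)).mp ?_ : α = 1)
    exact (sub_eq_zero.mp h0).trans (Real.rpow_one 2).symm
  rw [div_mul_eq_mul_div, eq_div_iff h2]
  linarith

/-! ### Interior of the cone and the main theorem -/

theorem mem_interior_entropyCone {x y z : ℝ} :
    ![x, y, z] ∈ interior entropyCone ↔ 0 < x ∧ 0 < y ∧ 0 < z := by
  constructor
  · intro h
    have key (i : Fin 3) (hi : entropyCone ⊆ Function.eval i ⁻¹' Set.Ici 0) :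
        0 < (![x, y, z] : Fin 3 → ℝ) i := by
      have h1 := interior_mono hi h
      rw [← (isOpenMap_eval i).preimage_interior_eq_interior_preimage (continuous_apply i),
        interior_Ici] at h1
      exact h1
    exact ⟨key 0 fun p hp => hp.1, key 1 fun p hp => hp.2.1, key 2 fun p hp => hp.2.2.1⟩
  · rintro ⟨hx, hy, hz⟩
    refine mem_interior.mpr ⟨{p | 0 < p 0} ∩ {p | 0 < p 1} ∩ {p | 0 < p 2}, ?_, ?_, ?_⟩
    · rintro p ⟨⟨h0, h1⟩, h2⟩
      exact ⟨le_of_lt h0, le_of_lt h1, le_of_lt h2, add_pos (add_pos h0 h1) h2⟩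
    · exact ((isOpen_lt continuous_const (continuous_apply 0)).inter
        (isOpen_lt continuous_const (continuous_apply 1))).inter
        (isOpen_lt continuous_const (continuous_apply 2))
    · exact ⟨⟨hx, hy⟩, hz⟩

theorem mainTheorem7 (ε₁ ε₂ ε₃ : ℝ) (hε₁ : 0 ≤ ε₁) (hε₂ : 0 ≤ ε₂) (hε₃ : 0 ≤ ε₃) (α : ℝ)
    (H : (Fin 3 → ℝ) → ℝ)
    (hsymm : ∀ p ∈ entropyCone, ∀ σ : Equiv.Perm (Fin 3), |H p - H (p ∘ σ)| ≤ ε₁)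
    (heq : ∀ x y z : ℝ, ![x, y, z] ∈ interior entropyCone →
      |H ![x, y, z] - H ![x + y, 0, z] - H ![x, y, 0]| ≤ ε₂)
    (hhom : ∀ t x y : ℝ, 0 < t → 0 < x → 0 < y →
      |H ![t * x, t * y, 0] - t ^ α * H ![x, y, 0]| ≤ ε₃) :
    (α = 1 → ∃ φ : ℝ → ℝ,
      (∀ x y : ℝ, 0 < x → 0 < y → φ (x * y) = x * φ y + y * φ x) ∧
      ∀ x y z : ℝ, ![x, y, z] ∈ interior entropyCone →
        |H ![x, y, z] - (φ (x + y + z) - φ x - φ y - φ z)| ≤ ε₁ + ε₂) ∧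
    (α = 0 → ∃ a : ℝ, ∀ x y z : ℝ, ![x, y, z] ∈ interior entropyCone →
      |H ![x, y, z] - a| ≤ 8 * ε₃ + 25 * ε₂ + 49 * ε₁) ∧
    (α ≠ 0 → α ≠ 1 → ∃ c : ℝ, ∀ x y z : ℝ, ![x, y, z] ∈ interior entropyCone →
      |H ![x, y, z] - c * ((x + y + z) ^ α - x ^ α - y ^ α - z ^ α)| ≤ ε₁ + ε₂) := by
  simp only [mem_interior_entropyCone] at heq ⊢
  set F : ℝ → ℝ → ℝ := fun x y => H ![x, y, 0] with hF
  replace hhom : ∀ t x y, 0 < t → 0 < x → 0 < y →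
    |F (t * x) (t * y) - t ^ α * F x y| ≤ ε₃ := hhom
  have hs (x y : ℝ) (hx : 0 < x) (hy : 0 < y) : |F x y - F y x| ≤ ε₁ := by
    have h := hsymm ![x, y, 0] ⟨hx.le, hy.le, le_rfl, by simp; positivity⟩ (Equiv.swap 0 1)
    convert h using 5
    ext i; fin_cases i <;> rfl
  have hHF (x y z : ℝ) (hx : 0 < x) (hy : 0 < y) (hz : 0 < z) :
      |H ![x, y, z] - (F (x + y) z + F x y)| ≤ ε₁ + ε₂ := by
    have h1 := heq x y z ⟨hx, hy, hz⟩
    have h2 := hsymm ![x + y, 0, z] ⟨(add_pos hx hy).le, le_rfl, hz.le, by simp; positivity⟩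
      (Equiv.swap 1 2)
    have h3 : (![x + y, 0, z] ∘ Equiv.swap 1 2 : Fin 3 → ℝ) = ![x + y, z, 0] := by
      ext i; fin_cases i <;> rfl
    rw [h3] at h2
    simp only [hF]
    rw [abs_le] at *
    constructor <;> linarith
  -- Two uses of `hHF` and one cyclic permutation of the arguments of H.
  have hc (x y z : ℝ) (hx : 0 < x) (hy : 0 < y) (hz : 0 < z) :
      |F (x + y) z + F x y - (F (y + z) x + F y z)| ≤ 3 * ε₁ + 2 * ε₂ := by
    have h1 := hHF x y z hx hy hz
    have h2 := hHF y z x hy hz hx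
    have h3 := hsymm ![x, y, z] ⟨hx.le, hy.le, hz.le, by simp; positivity⟩ (finRotate 3)
    have h4 : (![x, y, z] ∘ finRotate 3 : Fin 3 → ℝ) = ![y, z, x] := by
      ext i; fin_cases i <;> rfl
    rw [h4] at h3
    rw [abs_le] at *
    constructor <;> linarith
  have hh' (hα : α ≠ 0) := homogeneous_of_approx F hα hhom
  have hs' (hα : α ≠ 0) (x y : ℝ) (hx : 0 < x) (hy : 0 < y) : F x y = F y x := by
    refine sub_eq_zero.mp (eq_zero_of_rpow_mul_abs_le (C := ε₁) hα fun s hs0 => ?_)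
    have h1 := hs (s * x) (s * y) (by positivity) (by positivity)
    rw [hh' hα s x y hs0 hx hy, hh' hα s y x hs0 hy hx, ← mul_sub, abs_mul,
      abs_of_pos (Real.rpow_pos_of_pos hs0 α)] at h1
    exact h1
  have hc' (hα : α ≠ 0) (x y z : ℝ) (hx : 0 < x) (hy : 0 < y) (hz : 0 < z) :
      F (x + y) z + F x y = F (y + z) x + F y z := by
    refine sub_eq_zero.mp
      (eq_zero_of_rpow_mul_abs_le (C := 3 * ε₁ + 2 * ε₂) hα fun s hs0 => ?_)
    have h1 := hc (s * x) (s * y) (s * z) (by positivity) (by positivity) (by positivity)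
    rw [← mul_add, ← mul_add, hh' hα s x y hs0 hx hy, hh' hα s y z hs0 hy hz,
      hh' hα s _ z hs0 (add_pos hx hy) hz, hh' hα s _ x hs0 (add_pos hy hz) hx,
      ← mul_add, ← mul_add, ← mul_sub, abs_mul,
      abs_of_pos (Real.rpow_pos_of_pos hs0 α)] at h1
    exact h1
  refine ⟨?_, ?_, ?_⟩
  · rintro rfl
    obtain ⟨φ, hφ, hφF⟩ := exists_leibniz_of_homogeneous_cocycle F (hs' one_ne_zero)
      (hc' one_ne_zero) (by simpa using hh' one_ne_zero)
    refine ⟨φ, hφ, fun x y z ⟨hx, hy, hz⟩ => ?_⟩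
    have h := hHF x y z hx hy hz
    rw [hφF x y hx hy, hφF (x + y) z (add_pos hx hy) hz] at h
    convert h using 2
    ring
  · rintro rfl
    simp only [Real.rpow_zero, one_mul] at hhom
    have hdiag (w : ℝ) (hw : 0 < w) : |F w w - F 1 1| ≤ ε₃ := by
      simpa using hhom w 1 1 hw one_pos one_pos
    -- Doubling costs ε₁ + 3(3ε₁ + 2ε₂); three diagonal values and one dilation by 2 cost 4ε₃.
    have hconst (x y : ℝ) (hx : 0 < x) (hy : 0 < y) :
        |F x y - F 1 1| ≤ 4 * ε₃ + 10 * ε₁ + 6 * ε₂ := by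
      have h1 := abs_cocycle_doubling_le F _ _ hs hc x y hx hy
      have h2 := hdiag _ (add_pos hx hy)
      have h3 := hdiag x hx
      have h4 := hdiag y hy
      have h5 := hhom 2 x y two_pos hx hy
      rw [abs_le] at *
      constructor <;> linarith
    -- The argument yields 8ε₃ + 13ε₂ + 21ε₁, which is within the stated bound.
    refine ⟨2 * F 1 1, fun x y z ⟨hx, hy, hz⟩ => ?_⟩
    have h1 := hHF x y z hx hy hz
    have h2 := hconst x y hx hy
    have h3 := hconst (x + y) z (add_pos hx hy) hz
    rw [abs_le] at *
    constructor <;> linarith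
  · intro hα0 hα1
    have hF' := eq_rpow_of_homogeneous_cocycle F hα1 (hs' hα0) (hc' hα0) (hh' hα0)
    refine ⟨F 1 1 / (2 ^ α - 2), fun x y z ⟨hx, hy, hz⟩ => ?_⟩
    have h := hHF x y z hx hy hz
    rw [hF' x y hx hy, hF' (x + y) z (add_pos hx hy) hz] at h
    convert h using 2
    ring
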